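/- Let $M$ be a three-dimensional smooth manifold with a smooth complex-valued metric $g_{ab}$, i.e. a smooth field of symmetric nondegenerate complex-bilinear forms on the complexified tangent bundle $\mathbb{C}\otimes TM$ (for instance the complex-bilinear extension of a pseudo-Riemannian metric of any signature). Let $\nabla_a$ be its Levi-Civita connection. Define the curvature by $R_{abd}{}^{c}V^d = 2\nabla_{[a}\nabla_{b]}V^c$, and put $$R_{ab}=R_{acb}{}^{c},\quad R=g^{ab}R_{ab},\quad \Phi_{ab}=R_{ab}-\tfrac13 R\,g_{ab},\quad S=\tfrac1{12}R,$$ $$P_{ab}=-\Phi_{ab}-\tfrac1{12}R\,g_{ab},\qquad A_{abc}=2\nabla_{[b}P_{c]a},$$ so that $\Phi_{ab}$ is the tracefree Ricci tensor and $A_{abc}$ the Cotton tensor. A null structure $\mathcal N$ is a smooth complex line subbundle of $\mathbb{C}\otimes TM$ with $g_{ab}k^ak^b=0$ for all $k^a\in\mathcal N$; a generator of $\mathcal N$ is a (local) nowhere vanishing smooth section of it. $\mathcal N$ is co-geodetic if $g(\nabla_XY,Z)=0$ for all sections $X,Y$ of $\mathcal N^\perp$ and $Z$ of $\mathcal N$.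 A null frame at $p\in M$ is a triple $(k^a,\ell^a,n^a)$ of complex tangent vectors at $p$ with $g_{ab}=2k_{(a}\ell_{b)}-2n_an_b$. Put $\xi^a(z)=k^a+2z\,n^a+z^2\ell^a$ and $\Phi(z)=\tfrac12\Phi_{ab}\xi^a(z)\xi^b(z)$, a polynomial in $z$ of degree at most $4$. A complex line at $p$ is a multiple principal null line of $\Phi_{ab}$ if, in some null frame, it is spanned by $\xi^a(z_0)$ with $(z-z_0)^2$ dividing $\Phi(z)$ (the case where $\Phi(z)$ is identically zero is included). $\Phi_{ab}$ is algebraically special at $p$ if it has a multiple principal null line at $p$, and $\mathcal N$ is a multiple principal null structure if $\mathcal N_p$ is a multiple principal null line at every $p$. **Theorem.** Let $\mathcal N$ be a co-geodetic null structure on $(M,g)$, and suppose that for any generator $k^a$ of $\mathcal N$ $$k^ak^b\left(A_{abc}+3\,g_{bc}\nabla_aS\right)=0 .$$ Then $\Phi_{ab}$ is algebraically special at every point, with $\mathcal N$ as multiple principal null structure. -/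

import Mathlib

open scoped Manifold ContDiff TensorProduct

namespace NullGeometry

noncomputable section

/-- Coordinate space of dimension three. -/
abbrev E3 : Type := EuclideanSpace ℝ (Fin 3)

/-- Component functions of a symmetric bilinear form on coordinate space, as functions of the
coordinates. -/
abbrev MetricComponents : Type := E3 → Matrix (Fin 3) (Fin 3) ℂ

/-! ### Tensor calculus in coordinates

Everything in this part is written for the component functions `G = (g_ab)` of a complex-valued
metric in a coordinate system.  Indices are `a b c d : Fin 3`. -/

/-- The coordinate derivative `∂_a f` of a complex-valued function. -/
def pd (a : Fin 3) (f : E3 → ℂ) (x : E3) : ℂ :=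
  fderiv ℝ f x (EuclideanSpace.single a 1)

namespace MetricComponents

/-- The bilinear form `g_ab v^a w^b` at the point with coordinates `x`. -/
def inner (G : MetricComponents) (x : E3) (v w : Fin 3 → ℂ) : ℂ :=
  ∑ a, ∑ b, G x a b * v a * w b

/-- The inverse metric `g^ab`. -/
def inv (G : MetricComponents) (x : E3) : Matrix (Fin 3) (Fin 3) ℂ := (G x)⁻¹

/-- The Christoffel symbols `Γ^c_ab` of the Levi-Civita connection;
`christoffel G c a b = ½ g^cd (∂_a g_bd + ∂_b g_ad - ∂_d g_ab)`. -/
def christoffel (G : MetricComponents) (c a b : Fin 3) (x : E3) : ℂ :=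
  (1 / 2 : ℂ) * ∑ d, inv G x c d *
    (pd a (fun y => G y b d) x + pd b (fun y => G y a d) x - pd d (fun y => G y a b) x)

/-- The components `(∇_X Y)^c = X^a (∂_a Y^c + Γ^c_ab Y^b)` of the covariant derivative of complex
vector fields. -/
def nabla (G : MetricComponents) (X Y : E3 → Fin 3 → ℂ) (x : E3) (c : Fin 3) : ℂ :=
  ∑ a, X x a * (pd a (fun y => Y y c) x + ∑ b, christoffel G c a b x * Y x b)

/-- The Riemann tensor with the convention `R_{abd}^c V^d = ∇_a ∇_b V^c - ∇_b ∇_a V^c`;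
`riemann G a b d c` is `R_{abd}^c`. -/
def riemann (G : MetricComponents) (a b d c : Fin 3) (x : E3) : ℂ :=
  pd a (christoffel G c b d) x - pd b (christoffel G c a d) x
    + ∑ e, (christoffel G c a e x * christoffel G e b d x
      - christoffel G c b e x * christoffel G e a d x)

/-- The Ricci tensor `R_ab = R_{acb}^c`. -/
def ricci (G : MetricComponents) (a b : Fin 3) (x : E3) : ℂ :=
  ∑ c, riemann G a c b c x

/-- The Ricci scalar `R = g^ab R_ab`. -/
def ricciScalar (G : MetricComponents) (x : E3) : ℂ :=
  ∑ a, ∑ b, inv G x a b * ricci G a b x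

/-- The tracefree Ricci tensor `Φ_ab = R_ab - (1/3) R g_ab`. -/
def tracefreeRicci (G : MetricComponents) (a b : Fin 3) (x : E3) : ℂ :=
  ricci G a b x - (1 / 3 : ℂ) * ricciScalar G x * G x a b

/-- The scalar `S = R / 12`. -/
def scalarS (G : MetricComponents) (x : E3) : ℂ :=
  (1 / 12 : ℂ) * ricciScalar G x

/-- The Schouten tensor `P_ab = - Φ_ab - (1/12) R g_ab`. -/
def schouten (G : MetricComponents) (a b : Fin 3) (x : E3) : ℂ :=
  - tracefreeRicci G a b x - (1 / 12 : ℂ) * ricciScalar G x * G x a b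

/-- The covariant derivative of the Schouten tensor;
`nablaSchouten G b c a = ∇_b P_ca = ∂_b P_ca - Γ^d_bc P_da - Γ^d_ba P_cd`. -/
def nablaSchouten (G : MetricComponents) (b c a : Fin 3) (x : E3) : ℂ :=
  pd b (schouten G c a) x - ∑ d, christoffel G d b c x * schouten G d a x
    - ∑ d, christoffel G d b a x * schouten G c d x

/-- The Cotton tensor `A_abc = 2 ∇_[b P_c]a = ∇_b P_ca - ∇_c P_ba`. -/
def cotton (G : MetricComponents) (a b c : Fin 3) (x : E3) : ℂ :=
  nablaSchouten G b c a x - nablaSchouten G c b a x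

/-- The vectors `k, l, n` form a null frame at `x`: `g_ab = 2 k_(a l_b) - 2 n_a n_b`, with indices
lowered by the metric. -/
def IsNullFrame (G : MetricComponents) (x : E3) (k l n : Fin 3 → ℂ) : Prop :=
  ∀ a b : Fin 3,
    G x a b = (∑ c, G x a c * k c) * (∑ c, G x b c * l c)
      + (∑ c, G x a c * l c) * (∑ c, G x b c * k c)
      - 2 * (∑ c, G x a c * n c) * (∑ c, G x b c * n c)

end MetricComponents

/-- The null vector `ξ(z) = k + 2 z n + z² l` determined by a null frame and `z ∈ ℂ`. -/
def xiVec (k l n : Fin 3 → ℂ) (z : ℂ) : Fin 3 → ℂ :=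
  fun a => k a + 2 * z * n a + z ^ 2 * l a

/-- The component `ξ^a(z) = k^a + 2 z n^a + z² l^a` as a polynomial in `z`. -/
def xiPoly (k l n : Fin 3 → ℂ) (a : Fin 3) : Polynomial ℂ :=
  Polynomial.C (k a) + Polynomial.C (2 * n a) * Polynomial.X
    + Polynomial.C (l a) * Polynomial.X ^ 2

/-- The quartic polynomial `Φ(z) = ½ Φ_ab ξ^a(z) ξ^b(z)` of the tracefree Ricci tensor at `x`. -/
def MetricComponents.ricciPoly (G : MetricComponents) (x : E3) (k l n : Fin 3 → ℂ) :
    Polynomial ℂ :=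
  Polynomial.C (1 / 2 : ℂ) *
    ∑ a, ∑ b, Polynomial.C (G.tracefreeRicci a b x) * xiPoly k l n a * xiPoly k l n b

/-! ### Manifolds, complex-valued metrics and null structures -/

/-- The complexified tangent space `ℂ ⊗ T_p M`. -/
abbrev CTangent {M : Type*} [TopologicalSpace M] [ChartedSpace E3 M] (p : M) : Type :=
  ℂ ⊗[ℝ] TangentSpace (𝓡 3) p

/-- The smooth charts of `M`. -/
abbrev charts (M : Type*) [TopologicalSpace M] [ChartedSpace E3 M] :
    Set (OpenPartialHomeomorph M E3) :=
  IsManifold.maximalAtlas (𝓡 3) ∞ M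

variable {M : Type*} [TopologicalSpace M] [ChartedSpace E3 M]

/-- The coordinate vector `∂_a` of the chart `e`, at the point with coordinates `x`. -/
def coordVec (e : OpenPartialHomeomorph M E3) (x : E3) (a : Fin 3) :
    TangentSpace (𝓡 3) (e.symm x) :=
  mfderiv 𝓘(ℝ, E3) (𝓡 3) e.symm x (EuclideanSpace.single a (1 : ℝ) : E3)

/-- The complex tangent vector `v^a ∂_a` with components `v` in the chart `e`, at the point with
coordinates `x`. -/
def ofComponents (e : OpenPartialHomeomorph M E3) (x : E3) (v : Fin 3 → ℂ) :
    CTangent (e.symm x) :=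
  ∑ a, v a ⊗ₜ[ℝ] coordVec e x a

/-- The components `g_ab` in the chart `e` of a family of complex-bilinear forms on the
complexified tangent spaces. -/
def formComponents (B : ∀ p : M, LinearMap.BilinForm ℂ (CTangent p))
    (e : OpenPartialHomeomorph M E3) : MetricComponents :=
  fun x => Matrix.of fun a b =>
    B (e.symm x) ((1 : ℂ) ⊗ₜ[ℝ] coordVec e x a) ((1 : ℂ) ⊗ₜ[ℝ] coordVec e x b)

variable (M) in
/-- A smooth complex-valued metric on `M`: a smooth family of symmetric nondegenerate
complex-bilinear forms on the complexified tangent spaces.  The complex-bilinear extension of a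
real pseudo-Riemannian metric of any signature is of this kind. -/
structure ComplexMetric where
  /-- The bilinear form at a point. -/
  form : ∀ p : M, LinearMap.BilinForm ℂ (CTangent p)
  symm : ∀ (p : M) (v w : CTangent p), form p v w = form p w v
  nondegenerate : ∀ (p : M) (v : CTangent p), (∀ w : CTangent p, form p v w = 0) → v = 0
  smooth : ∀ e ∈ charts M, ∀ a b : Fin 3,
    ContDiffOn ℝ ∞ (fun x => formComponents form e x a b) e.target

/-- The components `g_ab` of a complex-valued metric in the chart `e`. -/
def ComplexMetric.components (g : ComplexMetric M) (e : OpenPartialHomeomorph M E3) :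
    MetricComponents :=
  formComponents g.form e

/-- On the set `U` of coordinate values in the chart `e`, the complex vector field with components
`k` is smooth and spans the field of subspaces `N` at each point. -/
def IsGeneratorOn (N : ∀ p : M, Submodule ℂ (CTangent p)) (e : OpenPartialHomeomorph M E3)
    (U : Set E3) (k : E3 → Fin 3 → ℂ) : Prop :=
  ContDiffOn ℝ ∞ k U ∧ ∀ x ∈ U, N (e.symm x) = Submodule.span ℂ {ofComponents e x (k x)}

/-- A null structure: a smooth complex line subbundle of the complexified tangent bundle that is
null with respect to the metric. -/
structure NullStructure (g : ComplexMetric M) where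
  /-- The line at a point. -/
  line : ∀ p : M, Submodule ℂ (CTangent p)
  finrank_line : ∀ p : M, Module.finrank ℂ (line p) = 1
  null : ∀ (p : M), ∀ v ∈ line p, g.form p v v = 0
  smooth : ∀ e ∈ charts M, ∀ x ∈ e.target, ∃ U : Set E3, IsOpen U ∧ x ∈ U ∧ U ⊆ e.target ∧
    ∃ k : E3 → Fin 3 → ℂ, IsGeneratorOn line e U k

namespace NullStructure

variable {g : ComplexMetric M}

/-- The orthogonal complement `N^⊥` at a point. -/
def perp (N : NullStructure g) (p : M) : Set (CTangent p) :=
  {v | ∀ w ∈ N.line p, g.form p v w = 0}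

/-- The null structure `N` is co-geodetic: `g(∇_X Y, Z) = 0` for all smooth local sections
`X, Y` of `N^⊥` and `Z` of `N`. -/
def IsCoGeodetic (N : NullStructure g) : Prop :=
  ∀ e ∈ charts M, ∀ U : Set E3, IsOpen U → U ⊆ e.target →
    ∀ X Y Z : E3 → Fin 3 → ℂ,
      ContDiffOn ℝ ∞ X U → ContDiffOn ℝ ∞ Y U → ContDiffOn ℝ ∞ Z U →
      (∀ x ∈ U, ofComponents e x (X x) ∈ N.perp (e.symm x)) →
      (∀ x ∈ U, ofComponents e x (Y x) ∈ N.perp (e.symm x)) →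
      (∀ x ∈ U, ofComponents e x (Z x) ∈ N.line (e.symm x)) →
      ∀ x ∈ U, (g.components e).inner x ((g.components e).nabla X Y x) (Z x) = 0

/-- The condition `k^a k^b (A_abc + 3 g_bc ∇_a S) = 0` for every smooth local generator `k` of
the null structure. -/
def CottonCondition (N : NullStructure g) : Prop :=
  ∀ e ∈ charts M, ∀ U : Set E3, IsOpen U → U ⊆ e.target →
    ∀ k : E3 → Fin 3 → ℂ, IsGeneratorOn N.line e U k →
      ∀ x ∈ U, ∀ c : Fin 3,
        ∑ a, ∑ b, k x a * k x b * ((g.components e).cotton a b c x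
          + 3 * g.components e x b c * pd a (g.components e).scalarS x) = 0

end NullStructure

/-- The line `L` at the point with coordinates `x` in the chart `e` is a multiple principal null
line of the tracefree Ricci tensor: in some null frame, `L` is spanned by `ξ(z)` for a multiple
root `z` of the polynomial `Φ`.  If `Φ` vanishes identically, every `z` counts as a multiple
root. -/
def ComplexMetric.IsMultiplePrincipalAt (g : ComplexMetric M) (e : OpenPartialHomeomorph M E3)
    (x : E3) (L : Submodule ℂ (CTangent (e.symm x))) : Prop :=
  ∃ k l n : Fin 3 → ℂ, (g.components e).IsNullFrame x k l n ∧
    ∃ z : ℂ, L = Submodule.span ℂ {ofComponents e x (xiVec k l n z)} ∧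
      (Polynomial.X - Polynomial.C z) ^ 2 ∣ (g.components e).ricciPoly x k l n

/-- The tracefree Ricci tensor is algebraically special at the point with coordinates `x` in the
chart `e`: it admits a multiple principal null line there. -/
def ComplexMetric.IsAlgebraicallySpecialAt (g : ComplexMetric M)
    (e : OpenPartialHomeomorph M E3) (x : E3) : Prop :=
  ∃ L : Submodule ℂ (CTangent (e.symm x)), g.IsMultiplePrincipalAt e x L

end

end NullGeometry

/-! The statement is local. Near a point, a generator `k` of the null structure extends to a smooth
null frame `k, l, n`, and `k, n` span the orthogonal complement of `k`. Being co-geodetic means that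
`∇_k` and `∇_n` send `k` and `n` to multiples of `k`: `∇_k k = εk`, `∇_n k = αk`, `∇_k n = ak`, `∇_n
n = bk`. Put `t = g(∇_l n, k)`.

Then `R(k,n)k` is a multiple of `k`, so `Ric(k,k) = 0`. The other curvature components give `p :=
Ric(k,n) = k(t) = -(k(α) - n(ε) - (a-α)ε)` and `Ric(n,n) = 2(n(t) + t²)`. Contracted with `n` and
`l`, the Cotton condition becomes `k(p) = εp` and `k(Ric(n,n)) = (2a-4t)p`. Since `[k,n] = (a-α)k`,
the commutator on `t` yields `n(p) = (α-4t)p`, and the commutator on `p` then yields `-p² = 4p²`.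
Hence `5p² = 0` and `p = 0`. As `g(k,k) = g(k,n) = 0`, the tracefree Ricci tensor has the same
vanishing components, which are the two lowest coefficients of `Φ(z)`; so `z = 0`, the parameter of
`k`, is a multiple root.

This computation (`IsNull.ric_eq_zero`) is done over a commutative ring with commuting derivations,
where it reduces to polynomial identities. It is applied to the ring of smooth functions on an open
set, and `MetricComponents.ricci_eq_zero` brings the result back to points. The frame comes from
`exists_nullFrame`. -/

namespace NullGeometry

/-! ### Connections on a free module of rank three over a ring with commuting derivations -/

namespace NullFrame

section Form

variable {A : Type*} [CommRing A] {G : Matrix (Fin 3) (Fin 3) A} {X Y Z : Fin 3 → A}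

/-- The bilinear form with matrix `G`. -/
def ip (G : Matrix (Fin 3) (Fin 3) A) (X Y : Fin 3 → A) : A :=
  ∑ a, ∑ b, G a b * X a * Y b

theorem ip_add_left : ip G (X + Y) Z = ip G X Z + ip G Y Z := by
  simp [ip, Fin.sum_univ_three]; ring

theorem ip_sub_left : ip G (X - Y) Z = ip G X Z - ip G Y Z := by
  simp [ip, Fin.sum_univ_three]; ring

theorem ip_smul_left (r : A) : ip G (r • X) Z = r * ip G X Z := by
  simp [ip, Fin.sum_univ_three]; ring

theorem ip_add_right : ip G X (Y + Z) = ip G X Y + ip G X Z := by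
  simp [ip, Fin.sum_univ_three]; ring

theorem ip_sub_right : ip G X (Y - Z) = ip G X Y - ip G X Z := by
  simp [ip, Fin.sum_univ_three]; ring

theorem ip_smul_right (r : A) : ip G X (r • Y) = r * ip G X Y := by
  simp [ip, Fin.sum_univ_three]; ring

theorem ip_comm (hG : ∀ a b, G a b = G b a) : ip G X Y = ip G Y X := by
  simp only [ip, Fin.sum_univ_three, hG 1 0, hG 2 0, hG 2 1]; ring

end Form

variable {A : Type*} [CommRing A] [Algebra ℂ A]

/-- The directional derivative `X^a ∂_a`. -/
def dir (D : Fin 3 → Derivation ℂ A A) (X : Fin 3 → A) : Derivation ℂ A A :=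
  ∑ a, X a • D a

/-- The covariant derivative with connection coefficients `Γ c a b = Γ^c_ab`. -/
def conn (D : Fin 3 → Derivation ℂ A A) (Γ : Fin 3 → Fin 3 → Fin 3 → A) (X Y : Fin 3 → A) :
    Fin 3 → A :=
  fun c => ∑ a, X a * (D a (Y c) + ∑ b, Γ c a b * Y b)

/-- The components `R_{abd}^c` of the curvature. -/
def riem (D : Fin 3 → Derivation ℂ A A) (Γ : Fin 3 → Fin 3 → Fin 3 → A) (a b d c : Fin 3) : A :=
  D a (Γ c b d) - D b (Γ c a d) + ∑ e, (Γ c a e * Γ e b d - Γ c b e * Γ e a d)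

/-- The curvature operator `R(X, Y) Z`. -/
def curv (D : Fin 3 → Derivation ℂ A A) (Γ : Fin 3 → Fin 3 → Fin 3 → A) (X Y Z : Fin 3 → A) :
    Fin 3 → A :=
  fun c => ∑ a, ∑ b, ∑ d, X a * Y b * Z d * riem D Γ a b d c

/-- The Ricci tensor as a matrix. -/
def ric (D : Fin 3 → Derivation ℂ A A) (Γ : Fin 3 → Fin 3 → Fin 3 → A) :
    Matrix (Fin 3) (Fin 3) A :=
  Matrix.of fun a b => ∑ c, riem D Γ a c b c

/-- The covariant derivative of a bilinear form, `nablaForm b c a = ∇_b P_ca`. -/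
def nablaForm (D : Fin 3 → Derivation ℂ A A) (Γ : Fin 3 → Fin 3 → Fin 3 → A)
    (P : Matrix (Fin 3) (Fin 3) A) (b c a : Fin 3) : A :=
  D b (P c a) - ∑ d, Γ d b c * P d a - ∑ d, Γ d b a * P c d

variable {D : Fin 3 → Derivation ℂ A A} {Γ : Fin 3 → Fin 3 → Fin 3 → A}
  {G P : Matrix (Fin 3) (Fin 3) A} {X Y Z W : Fin 3 → A} {f : A}

theorem dir_apply : dir D X f = ∑ a, X a * D a f := by
  simp [dir, Fin.sum_univ_three]

theorem dir_smul (r : A) : dir D (r • X) f = r * dir D X f := by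
  simp [dir_apply, Fin.sum_univ_three]; ring

theorem conn_add_left : conn D Γ (X + Y) Z = conn D Γ X Z + conn D Γ Y Z := by
  ext c; simp [conn, Fin.sum_univ_three]; ring

theorem conn_sub_left : conn D Γ (X - Y) Z = conn D Γ X Z - conn D Γ Y Z := by
  ext c; simp [conn, Fin.sum_univ_three]; ring

theorem conn_smul_left (r : A) : conn D Γ (r • X) Z = r • conn D Γ X Z := by
  ext c; simp [conn, Fin.sum_univ_three]; ring

theorem conn_add_right : conn D Γ X (Y + Z) = conn D Γ X Y + conn D Γ X Z := by
  ext c; simp [conn, Fin.sum_univ_three]; ring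

theorem conn_smul_right (r : A) :
    conn D Γ X (r • Y) = dir D X r • Y + r • conn D Γ X Y := by
  ext c; simp [conn, dir_apply, Fin.sum_univ_three]; ring

/-- The curvature as a commutator of covariant derivatives. -/
theorem curv_eq (hD : ∀ a b f, D a (D b f) = D b (D a f)) (hΓ : ∀ c a b, Γ c a b = Γ c b a) :
    curv D Γ X Y Z = conn D Γ X (conn D Γ Y Z) - conn D Γ Y (conn D Γ X Z)
      - conn D Γ (conn D Γ X Y - conn D Γ Y X) Z := by
  have h : conn D Γ X Y - conn D Γ Y X = fun c => dir D X (Y c) - dir D Y (X c) := by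
    ext c
    simp only [conn, dir_apply, Pi.sub_apply, Fin.sum_univ_three, hΓ c 1 0, hΓ c 2 0, hΓ c 2 1]
    ring
  rw [h]
  ext c
  simp only [curv, riem, conn, dir_apply, Pi.sub_apply, Fin.sum_univ_three, map_add,
    Derivation.leibniz, smul_eq_mul, hD 1 0, hD 2 0, hD 2 1]
  ring

/-- Vanishing torsion, as the commutator of directional derivatives. -/
theorem dir_commutator (hD : ∀ a b f, D a (D b f) = D b (D a f))
    (hΓ : ∀ c a b, Γ c a b = Γ c b a) :
    dir D X (dir D Y f) - dir D Y (dir D X f) = dir D (conn D Γ X Y - conn D Γ Y X) f := by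
  simp only [conn, dir_apply, Pi.sub_apply, Fin.sum_univ_three, hΓ _ 1 0, hΓ _ 2 0, hΓ _ 2 1,
    map_add, Derivation.leibniz, smul_eq_mul, hD 1 0, hD 2 0, hD 2 1]
  ring

/-- The Leibniz rule for a bilinear form. -/
theorem sum_nablaForm :
    ∑ b, ∑ c, ∑ a, X b * Y c * Z a * nablaForm D Γ P b c a =
      dir D X (ip P Y Z) - ip P (conn D Γ X Y) Z - ip P Y (conn D Γ X Z) := by
  simp only [nablaForm, ip, conn, dir_apply, Fin.sum_univ_three, map_add,
    Derivation.leibniz, smul_eq_mul]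
  ring

theorem dir_ip (hG : ∀ b c a, nablaForm D Γ G b c a = 0) :
    dir D X (ip G Y Z) = ip G (conn D Γ X Y) Z + ip G Y (conn D Γ X Z) := by
  have := sum_nablaForm (D := D) (Γ := Γ) (P := G) (X := X) (Y := Y) (Z := Z)
  simp only [hG, mul_zero, Finset.sum_const_zero] at this
  linear_combination -this

theorem curv_swap : curv D Γ X Y Z = - curv D Γ Y X Z := by
  ext c
  simp only [curv, riem, Pi.neg_apply, Fin.sum_univ_three]
  ring

theorem curv_self : curv D Γ X X Z = 0 := by
  ext c
  simp only [curv, riem, Pi.zero_apply, Fin.sum_univ_three]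
  ring

/-- The first Bianchi identity. -/
theorem curv_cyclic (hΓ : ∀ c a b, Γ c a b = Γ c b a) :
    curv D Γ X Y Z + curv D Γ Y Z X + curv D Γ Z X Y = 0 := by
  ext c
  simp only [curv, riem, Pi.zero_apply, Pi.add_apply, Fin.sum_univ_three, hΓ _ 1 0, hΓ _ 2 0,
    hΓ _ 2 1]
  ring

/-- The curvature is skew with respect to a parallel metric. -/
theorem ip_curv_skew (hD : ∀ a b f, D a (D b f) = D b (D a f))
    (hΓ : ∀ c a b, Γ c a b = Γ c b a) (hG : ∀ b c a, nablaForm D Γ G b c a = 0) :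
    ip G (curv D Γ X Y Z) W = - ip G Z (curv D Γ X Y W) := by
  have h := dir_commutator (X := X) (Y := Y) (f := ip G Z W) hD hΓ
  simp only [dir_ip hG, map_add] at h
  simp only [curv_eq hD hΓ, ip_sub_left, ip_sub_right]
  linear_combination h

/-- The pair symmetry of the curvature. -/
theorem ip_curv_pair (hD : ∀ a b f, D a (D b f) = D b (D a f))
    (hΓ : ∀ c a b, Γ c a b = Γ c b a) (hG : ∀ b c a, nablaForm D Γ G b c a = 0)
    (hs : ∀ a b, G a b = G b a) {half : A} (hh : 2 * half = 1) :
    ip G (curv D Γ X Y Z) W = ip G (curv D Γ Z W X) Y := by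
  have cyc : ∀ X Y Z W : Fin 3 → A, ip G (curv D Γ X Y Z) W + ip G (curv D Γ Y Z X) W
      + ip G (curv D Γ Z X Y) W = 0 := fun X Y Z W => by
    rw [← ip_add_left, ← ip_add_left, curv_cyclic hΓ]; simp [ip]
  have sk : ∀ X Y Z W : Fin 3 → A, ip G (curv D Γ X Y Z) W = - ip G (curv D Γ X Y W) Z :=
    fun X Y Z W => by rw [ip_curv_skew hD hΓ hG, ip_comm hs]
  have sw : ∀ X Y Z W : Fin 3 → A, ip G (curv D Γ X Y Z) W = - ip G (curv D Γ Y X Z) W :=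
    fun X Y Z W => by rw [curv_swap, ← neg_one_smul A, ip_smul_left, neg_one_mul]
  -- The octahedron argument: in a signed sum of the four Bianchi identities, skewness in each pair
  -- cancels every term except two equal copies of each side.
  have h : 2 * ip G (curv D Γ X Y Z) W = 2 * ip G (curv D Γ Z W X) Y := by
    linear_combination cyc X Y Z W + cyc Y Z W X - cyc Z W X Y - cyc W X Y Z - sk Y Z W X
      - sk Z W Y X + sw X Z W Y - sk Z X W Y + sk W X Y Z + sk X Y W Z + sw Y W X Z - sk W Y X Z
  linear_combination half * h + (ip G (curv D Γ Z W X) Y - ip G (curv D Γ X Y Z) W) * hh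


/-! ### Null frames and the curvature computation -/

/-- The vectors `k, l, n` form a null frame for the form `G`: they are dual to each other and the
resolution of the identity in terms of them holds. -/
structure IsNull {A : Type*} [CommRing A] (G : Matrix (Fin 3) (Fin 3) A) (k l n : Fin 3 → A) :
    Prop where
  kk : ip G k k = 0
  ll : ip G l l = 0
  kl : ip G k l = 1
  kn : ip G k n = 0
  ln : ip G l n = 0
  nn : 2 * ip G n n = -1
  resolution : ∀ a c, k c * ∑ b, G a b * l b + l c * ∑ b, G a b * k b
    - 2 * (n c * ∑ b, G a b * n b) = if a = c then 1 else 0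

theorem IsNull.expand {A : Type*} [CommRing A] {G : Matrix (Fin 3) (Fin 3) A}
    {k l n : Fin 3 → A} (h : IsNull G k l n) (v : Fin 3 → A) :
    v = ip G v l • k + ip G v k • l - (2 * ip G v n) • n := by
  have hr := h.resolution
  ext c
  have : v c = ∑ a, v a * if a = c then 1 else 0 := by simp
  rw [this]
  simp only [← hr, ip, Fin.sum_univ_three, Pi.sub_apply, Pi.add_apply, Pi.smul_apply, smul_eq_mul]
  ring

variable {A : Type*} [CommRing A] [Algebra ℂ A]
variable {D : Fin 3 → Derivation ℂ A A} {Γ : Fin 3 → Fin 3 → Fin 3 → A}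
  {G : Matrix (Fin 3) (Fin 3) A} {X Y k l n : Fin 3 → A}

/-- The Ricci tensor as a trace over a null frame. -/
theorem IsNull.ip_ric (h : IsNull G k l n) :
    ip (ric D Γ) X Y = ip G (curv D Γ X k Y) l + ip G (curv D Γ X l Y) k
      - 2 * ip G (curv D Γ X n Y) n := by
  -- `C` is the matrix of `Z ↦ R(X,Z)Y`. Ricci is its trace, which the resolution of the identity
  -- rewrites in the frame.
  obtain ⟨C, hC⟩ : ∃ C : Fin 3 → Fin 3 → A,
      ∀ c a, C c a = ∑ a', ∑ d, X a' * Y d * riem D Γ a' c d a := ⟨_, fun _ _ => rfl⟩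
  have hc : ∀ Z a, curv D Γ X Z Y a = ∑ c, Z c * C c a :=
    fun Z a => by simp only [curv, hC, Fin.sum_univ_three]; ring
  have hl : ip (ric D Γ) X Y = ∑ a, ∑ c, C c a * if a = c then 1 else 0 := by
    simp only [mul_ite, mul_one, mul_zero, Finset.sum_ite_eq, Finset.mem_univ, if_true]
    simp only [ip, ric, hC, Fin.sum_univ_three, Matrix.of_apply]
    ring
  rw [hl]
  simp only [← h.resolution, ip, hc, Fin.sum_univ_three]
  ring

/-- The covariant derivatives of the vectors of a null frame. -/
theorem IsNull.conn_eq (h : IsNull G k l n) (hG : ∀ b c a, nablaForm D Γ G b c a = 0)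
    (hs : ∀ a b, G a b = G b a) {half : A} (hh : 2 * half = 1) (X : Fin 3 → A) :
    conn D Γ X k = ip G (conn D Γ X k) l • k + (2 * ip G (conn D Γ X n) k) • n ∧
    conn D Γ X n = ip G (conn D Γ X n) l • k + ip G (conn D Γ X n) k • l ∧
    conn D Γ X l = (- ip G (conn D Γ X k) l) • l + (2 * ip G (conn D Γ X n) l) • n := by
  -- All products of frame vectors are constant, so differentiating them makes the connection matrix
  -- skew and leaves three free coefficients.
  have z : ∀ Y, dir D X (ip G Y Y) = 0 → ip G (conn D Γ X Y) Y = 0 := fun Y hY => by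
    have := dir_ip (X := X) (Y := Y) (Z := Y) hG
    rw [hY, ip_comm hs (X := Y)] at this
    linear_combination -half * this - ip G (conn D Γ X Y) Y * hh
  have s : ∀ Y Z, dir D X (ip G Y Z) = 0 → ip G (conn D Γ X Z) Y = - ip G (conn D Γ X Y) Z :=
    fun Y Z hY => by
      have := dir_ip (X := X) (Y := Y) (Z := Z) hG
      rw [hY, ip_comm hs (X := Y)] at this
      linear_combination -this
  have k0 := z k (by rw [h.kk, map_zero])
  have l0 := z l (by rw [h.ll, map_zero])
  have n0 := z n (by
    have h1 : dir D X (2 * ip G n n) = 0 := by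
      rw [h.nn, map_neg, Derivation.map_one_eq_zero, neg_zero]
    rw [two_mul, map_add] at h1
    linear_combination half * h1 - dir D X (ip G n n) * hh)
  have lk := s k l (by rw [h.kl, Derivation.map_one_eq_zero])
  have nk := s k n (by rw [h.kn, map_zero])
  have nl := s l n (by rw [h.ln, map_zero])
  refine ⟨?_, ?_, ?_⟩
  · conv_lhs => rw [h.expand (conn D Γ X k), k0]
    rw [nk]; module
  · conv_lhs => rw [h.expand (conn D Γ X n), n0]
    module
  · conv_lhs => rw [h.expand (conn D Γ X l), l0, lk]
    rw [nl]; module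

/-- For a co-geodetic null vector field `k` satisfying the condition on the Cotton tensor, the
components `Ric(k, k)` and `Ric(k, n)²` vanish. -/
theorem IsNull.ric_eq_zero (h : IsNull G k l n) (hD : ∀ a b f, D a (D b f) = D b (D a f))
    (hΓ : ∀ c a b, Γ c a b = Γ c b a) (hG : ∀ b c a, nablaForm D Γ G b c a = 0)
    (hs : ∀ a b, G a b = G b a) {half : A} (hh : 2 * half = 1)
    (hk : ip G (conn D Γ k n) k = 0) (hn : ip G (conn D Γ n n) k = 0) {σ : A}
    -- `σ` stands for `R/4 = 3S`, so that the Schouten tensor is `σg - Ric` and `3∇S = ∇σ`.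
    (hσ : 4 * σ = ip (ric D Γ) k l + ip (ric D Γ) l k - 2 * ip (ric D Γ) n n)
    (hA : ∀ c, ∑ a, ∑ b, k a * k b * (nablaForm D Γ (σ • G - ric D Γ) b c a
      - nablaForm D Γ (σ • G - ric D Γ) c b a + G b c * D a σ) = 0) :
    ip (ric D Γ) k k = 0 ∧ 5 * ip (ric D Γ) k n ^ 2 = 0 ∧
      ip (ric D Γ) n k = ip (ric D Γ) k n := by
  obtain ⟨Ckk, Ckn, Ckl⟩ := h.conn_eq hG hs hh k
  obtain ⟨Cnk, Cnn, Cnl⟩ := h.conn_eq hG hs hh n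
  obtain ⟨Clk, Cln, -⟩ := h.conn_eq hG hs hh l
  rw [hk] at Ckk Ckn
  rw [hn] at Cnk Cnn
  set ε := ip G (conn D Γ k k) l
  set α := ip G (conn D Γ n k) l
  set γ := ip G (conn D Γ l k) l
  set a := ip G (conn D Γ k n) l
  set b := ip G (conn D Γ n n) l
  set c := ip G (conn D Γ l n) l
  set t := ip G (conn D Γ l n) k
  simp only [mul_zero, zero_smul, add_zero] at Ckk Ckn Cnk Cnn
  have nn : ip G n n = -half := by
    linear_combination half * h.nn - ip G n n * hh
  have skew : ∀ X Y Z W, ip G (curv D Γ X Y Z) W = - ip G (curv D Γ X Y W) Z :=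
    fun X Y Z W => by rw [ip_curv_skew hD hΓ hG, ip_comm hs]
  have skew0 : ∀ X Y Z, ip G (curv D Γ X Y Z) Z = 0 := fun X Y Z => by
    linear_combination half * skew X Y Z Z - ip G (curv D Γ X Y Z) Z * hh
  have swap : ∀ X Y Z W, ip G (curv D Γ X Y Z) W = - ip G (curv D Γ Y X Z) W :=
    fun X Y Z W => by rw [curv_swap, ← neg_one_smul A, ip_smul_left, neg_one_mul]
  have same : ∀ X Z W, ip G (curv D Γ X X Z) W = 0 := fun X Z W => by
    rw [curv_self]; simp [ip]
  have pair : ∀ X Y Z W, ip G (curv D Γ X Y Z) W = ip G (curv D Γ Z W X) Y :=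
    fun X Y Z W => ip_curv_pair hD hΓ hG hs hh
  -- Both `∇_k` and `∇_n` preserve the line of `k`, and `[k,n]` is a multiple of `k`; hence so is
  -- `R(k,n)k`.
  have Rkn : curv D Γ k n k = (dir D k α - dir D n ε - (a - α) * ε) • k := by
    rw [curv_eq hD hΓ, Cnk, Ckk, Ckn, ← sub_smul, conn_smul_left, conn_smul_right,
      conn_smul_right, Cnk, Ckk]
    module
  have Rkl : ip G (curv D Γ k l k) n = - dir D k t := by
    rw [curv_eq hD hΓ, Clk, Ckk, Ckl]
    simp only [conn_sub_left, conn_add_left, conn_smul_left, conn_add_right, conn_smul_right, Clk,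
      Ckk, Cnk, Ckn, ip_sub_left, ip_add_left, ip_smul_left, h.kn, nn,
      Derivation.leibniz, smul_eq_mul]
    have h2 : dir D k (2 : A) = 0 := by
      exact_mod_cast (dir D k).map_natCast 2
    rw [h2]
    linear_combination - dir D k t * hh
  have Rnl : ip G (curv D Γ n l k) n = - dir D n t - t ^ 2 := by
    rw [curv_eq hD hΓ, Clk, Cnk, Cnl]
    simp only [conn_sub_left, conn_add_left, conn_smul_left, conn_add_right, conn_smul_right, Clk,
      Ckk, Cnk, Cnn, Cln, ip_sub_left, ip_add_left, ip_smul_left, h.kn, nn,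
      Derivation.leibniz, smul_eq_mul]
    have h2 : dir D n (2 : A) = 0 := by
      exact_mod_cast (dir D n).map_natCast 2
    rw [h2]
    linear_combination (- dir D n t - t ^ 2) * hh
  have ric_comm : ∀ X Y, ip (ric D Γ) X Y = ip (ric D Γ) Y X := fun X Y => by
    rw [h.ip_ric, h.ip_ric]
    linear_combination pair X k Y l + pair X l Y k - 2 * pair X n Y n
  have ric_kk : ip (ric D Γ) k k = 0 := by
    rw [h.ip_ric, same, skew0, Rkn, ip_smul_left, h.kn]; ring
  have ric_kn : ip (ric D Γ) k n = dir D k t := by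
    rw [h.ip_ric, same, skew0]
    linear_combination skew k l n k - Rkl
  -- A second expression for `Ric(k,n)`, by the symmetry of Ricci; comparing it with `k(t)` closes
  -- the argument.
  have ric_kn' : ip (ric D Γ) k n = -(dir D k α - dir D n ε - (a - α) * ε) := by
    rw [ric_comm, h.ip_ric, same, skew0, swap n k, Rkn, ip_smul_left, h.kl]
    ring
  have ric_nn : ip (ric D Γ) n n = 2 * (dir D n t + t ^ 2) := by
    rw [h.ip_ric, same, pair n k n l]
    linear_combination 2 * skew n l n k - 2 * Rnl
  -- The Cotton condition contracted with `Z`. Of the factor `2` on the right, one unit comes from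
  -- the `σg` part of the Schouten tensor and one from the `∇S` term.
  have cot : ∀ Z, dir D k (ip (ric D Γ) Z k) - ip (ric D Γ) (conn D Γ k Z) k
      - ip (ric D Γ) Z (conn D Γ k k) - (dir D Z (ip (ric D Γ) k k)
      - ip (ric D Γ) (conn D Γ Z k) k - ip (ric D Γ) k (conn D Γ Z k))
      = 2 * (ip G k Z * dir D k σ) := fun Z => by
    have ipP : ∀ X Y, ip (σ • G - ric D Γ) X Y = σ * ip G X Y - ip (ric D Γ) X Y :=
      fun X Y => by simp [ip, Fin.sum_univ_three]; ring
    have h1 : ∑ c, Z c * ∑ a, ∑ b, k a * k b * (nablaForm D Γ (σ • G - ric D Γ) b c a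
      - nablaForm D Γ (σ • G - ric D Γ) c b a + G b c * D a σ) = 0 := by simp [hA]
    have h2 : ∑ b, ∑ c, ∑ a, k b * Z c * k a * nablaForm D Γ (σ • G - ric D Γ) b c a
        - ∑ b, ∑ c, ∑ a, Z b * k c * k a * nablaForm D Γ (σ • G - ric D Γ) b c a
        + ip G k Z * dir D k σ = 0 := by
      rw [← h1]
      simp only [ip, dir_apply, Fin.sum_univ_three]
      ring
    rw [sum_nablaForm, sum_nablaForm] at h2
    simp only [ipP, map_sub, Derivation.leibniz, smul_eq_mul, dir_ip hG] at h2
    rw [ip_comm hs (X := Z) (Y := k), h.kk] at h2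
    linear_combination -h2
  set p := ip (ric D Γ) k n with hp
  have kp : dir D k p = ε * p := by
    have := cot n
    rw [Ckn, Ckk, Cnk, ric_kk, h.kn, ric_comm n k, ← hp] at this
    simp only [ip_smul_left, ip_smul_right, ric_kk, map_zero, ric_comm n k, ← hp] at this
    linear_combination this
  -- Taking `Z = l`, where `2k(σ) = k(Ric(k,l)) - k(Ric(n,n))`: the weight of the `∇S` term is
  -- exactly what cancels `k(Ric(k,l))`.
  have kq : dir D k (ip (ric D Γ) n n) = (2 * a - 4 * t) * p := by
    have := cot l
    rw [Ckl, Ckk, Clk, ric_kk, h.kl, ric_comm l k] at this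
    simp only [ip_smul_left, ip_smul_right, ip_add_left, ip_add_right, ric_kk, map_zero,
      ric_comm n k, ric_comm l k, ← hp] at this
    have h4 := congrArg (dir D k) hσ
    have e4 : (4 : A) * σ = σ + σ + σ + σ := by ring
    rw [ric_comm l k, two_mul, e4] at h4
    simp only [map_add, map_sub] at h4
    linear_combination this + half * h4 - (2 * dir D k σ - dir D k (ip (ric D Γ) k l)
      + dir D k (ip (ric D Γ) n n)) * hh
  have br : conn D Γ k n - conn D Γ n k = (a - α) • k := by
    rw [Ckn, Cnk]; module
  -- Compare `k(Ric(n,n))` with `k` applied to `2(n(t) + t²)`, and exchange `k` and `n` on `t`.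
  have np : dir D n p = (α - 4 * t) * p := by
    have h1 := dir_commutator (X := k) (Y := n) (f := t) hD hΓ
    rw [br, dir_smul, ← ric_kn] at h1
    rw [ric_nn, two_mul] at kq
    simp only [map_add, sq, Derivation.leibniz, smul_eq_mul, ← ric_kn] at kq
    linear_combination half * kq - h1 - (dir D k (dir D n t) + 2 * t * p - (a - 2 * t) * p) * hh
  -- Integrability of the system for `p`: after substitution only `(k(α) - n(ε) - (a-α)ε)p = 4p²`
  -- remains, whose left side is `-p²`.
  have h1 := dir_commutator (X := k) (Y := n) (f := p) hD hΓ
  rw [br, dir_smul, np, kp] at h1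
  have h4 : dir D k (4 * t) = 4 * p := by
    rw [ric_kn, show 4 * t = t + t + t + t by ring]
    simp only [map_add]
    ring
  rw [Derivation.leibniz, Derivation.leibniz, map_sub, h4] at h1
  simp only [smul_eq_mul, np, kp] at h1
  exact ⟨ric_kk, by linear_combination -h1 + p * ric_kn', ric_comm n k⟩


/-! ### The Levi-Civita connection built from a null frame -/

/-- The inverse metric determined by a null frame. -/
def coinv {A : Type*} [CommRing A] (k l n : Fin 3 → A) : Matrix (Fin 3) (Fin 3) A :=
  Matrix.of fun a b => k a * l b + l a * k b - 2 * (n a * n b)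

/-- The connection coefficients `half * H^cd (∂_a G_bd + ∂_b G_ad - ∂_d G_ab)`. -/
def levi {A : Type*} [CommRing A] [Algebra ℂ A] (D : Fin 3 → Derivation ℂ A A) (half : A)
    (G H : Matrix (Fin 3) (Fin 3) A) (c a b : Fin 3) : A :=
  half * ∑ d, H c d * (D a (G b d) + D b (G a d) - D d (G a b))

section Form

variable {A : Type*} [CommRing A] {G : Matrix (Fin 3) (Fin 3) A} {k l n : Fin 3 → A}

/-- The inner products say that the matrix of frame vectors times that of the dual covectors is the
identity. Over a commutative ring the product in the other order is the identity too, which is the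
resolution. -/
theorem IsNull.of_ip (kk : ip G k k = 0) (ll : ip G l l = 0) (kl : ip G k l = 1)
    (kn : ip G k n = 0) (ln : ip G l n = 0) (nn : 2 * ip G n n = -1)
    (hs : ∀ a b, G a b = G b a) : IsNull G k l n := by
  refine ⟨kk, ll, kl, kn, ln, nn, fun a c => ?_⟩
  have lk : ip G l k = 1 := by rw [ip_comm hs, kl]
  have nk : ip G n k = 0 := by rw [ip_comm hs, kn]
  have nl : ip G n l = 0 := by rw [ip_comm hs, ln]
  let B : Matrix (Fin 3) (Fin 3) A := !![k 0, k 1, k 2; l 0, l 1, l 2; n 0, n 1, n 2]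
  let C : Matrix (Fin 3) (Fin 3) A := Matrix.of fun a =>
    ![∑ b, G a b * l b, ∑ b, G a b * k b, -2 * ∑ b, G a b * n b]
  have h : B * C = 1 := by
    simp only [ip, Fin.sum_univ_three] at kk ll kl kn ln nn lk nk nl
    ext i j
    fin_cases i <;> fin_cases j <;>
      simp [B, C, Matrix.mul_apply, Fin.sum_univ_three]
    · linear_combination kl
    · linear_combination kk
    · linear_combination -2 * kn
    · linear_combination ll
    · linear_combination lk
    · linear_combination -2 * ln
    · linear_combination nl
    · linear_combination nk
    · linear_combination -nn
  have h2 : (C * B) a c = (1 : Matrix (Fin 3) (Fin 3) A) a c := by rw [mul_eq_one_comm.1 h]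
  rw [Matrix.one_apply] at h2
  rw [← h2, Matrix.mul_apply]
  fin_cases c <;> simp [B, C, Fin.sum_univ_three] <;> ring

theorem IsNull.mul_coinv (h : IsNull G k l n) : G * coinv k l n = 1 := by
  ext a c
  rw [Matrix.one_apply, ← h.resolution a c]
  simp only [Matrix.mul_apply, coinv, Matrix.of_apply, Fin.sum_univ_three]
  ring

/-- The trace of a matrix in a null frame. -/
theorem sum_coinv_mul {q : A} (hq : 12 * q = 1) (r : Matrix (Fin 3) (Fin 3) A) :
    4 * (3 * (q * ∑ a, ∑ b, coinv k l n a b * r a b)) =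
      ip r k l + ip r l k - 2 * ip r n n := by
  have h : ∑ a, ∑ b, coinv k l n a b * r a b = ip r k l + ip r l k - 2 * ip r n n := by
    simp only [ip, coinv, Matrix.of_apply, Fin.sum_univ_three]
    ring
  rw [h]
  linear_combination (ip r k l + ip r l k - 2 * ip r n n) * hq

theorem mul_algebraMap_eq_one {A : Type*} [CommRing A] [Algebra ℂ A] (m : ℕ) [m.AtLeastTwo] :
    (OfNat.ofNat m : A) * algebraMap ℂ A (1 / OfNat.ofNat m) = 1 := by
  rw [← map_ofNat (algebraMap ℂ A) m, ← map_mul, mul_one_div_cancel (NeZero.ne _), map_one]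

end Form

variable {A : Type*} [CommRing A] [Algebra ℂ A] {D : Fin 3 → Derivation ℂ A A}
  {G H : Matrix (Fin 3) (Fin 3) A} {half : A}

theorem levi_symm (hs : ∀ a b, G a b = G b a) (c a b : Fin 3) :
    levi D half G H c a b = levi D half G H c b a := by
  simp only [levi, Fin.sum_univ_three, hs b a]
  ring

theorem map_three_mul (d : Derivation ℂ A A) (s : A) : d (3 * s) = d s + d s + d s := by
  rw [← map_add, ← map_add]
  ring_nf

/-- The metric is parallel for its Levi-Civita connection. -/
theorem nablaForm_levi (hs : ∀ a b, G a b = G b a) (hH : G * H = 1) (hh : 2 * half = 1)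
    (b c a : Fin 3) : nablaForm D (levi D half G H) G b c a = 0 := by
  -- Lowering the upper index cancels the inverse metric; two of the resulting first-kind symbols
  -- add up to the derivative of the metric.
  have lower : ∀ e a b, ∑ d, levi D half G H d a b * G e d =
      half * (D a (G b e) + D b (G a e) - D e (G a b)) := fun e a b => by
    have h1 : ∀ d, (G * H) e d = if e = d then 1 else 0 := fun d => by
      rw [hH, Matrix.one_apply]
    have h2 : ∑ d, levi D half G H d a b * G e d =
        half * ∑ d, (G * H) e d * (D a (G b d) + D b (G a d) - D d (G a b)) := by
      simp only [levi, Matrix.mul_apply, Fin.sum_univ_three]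
      ring
    rw [h2]
    simp only [h1, ite_mul, one_mul, zero_mul, Finset.sum_ite_eq, Finset.mem_univ, if_true]
  simp only [nablaForm, lower, hs _ a]
  linear_combination - D b (G a c) * hh

end NullFrame

/-! ### The ring of smooth functions on an open set of coordinate space -/

open TopologicalSpace (Opens)

/-- The complex-valued smooth functions on an open set. -/
def smoothSubalgebra (U : Opens E3) : Subalgebra ℂ (U → ℂ) where
  carrier := {f | ∃ F : E3 → ℂ, ContDiffOn ℝ ∞ F U ∧ ∀ u : U, f u = F u}
  mul_mem' := by
    rintro f g ⟨F, hF, hf⟩ ⟨F', hF', hg⟩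
    exact ⟨fun x => F x * F' x, hF.mul hF', fun u => by simp [hf, hg]⟩
  add_mem' := by
    rintro f g ⟨F, hF, hf⟩ ⟨F', hF', hg⟩
    exact ⟨fun x => F x + F' x, hF.add hF', fun u => by simp [hf, hg]⟩
  algebraMap_mem' r := ⟨fun _ => r, contDiffOn_const, fun u => rfl⟩

/-- The ring of complex-valued smooth functions on an open set. -/
def smoothRing (U : Opens E3) : Type := smoothSubalgebra U

noncomputable instance (U : Opens E3) : CommRing (smoothRing U) :=
  inferInstanceAs (CommRing (smoothSubalgebra U))

noncomputable instance (U : Opens E3) : Algebra ℂ (smoothRing U) :=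
  inferInstanceAs (Algebra ℂ (smoothSubalgebra U))

namespace smoothRing

variable {U : Opens E3}

/-- The restriction of a function which is smooth on `U`. -/
def restrict (F : E3 → ℂ) (hF : ContDiffOn ℝ ∞ F U) : smoothRing U :=
  (⟨fun u => F u, F, hF, fun _ => rfl⟩ : smoothSubalgebra U)

/-- Evaluation at a point. -/
noncomputable def ev (u : U) : smoothRing U →ₐ[ℂ] ℂ :=
  ((Pi.evalAlgHom ℂ (fun _ : U => ℂ) u).comp (smoothSubalgebra U).val :
    smoothSubalgebra U →ₐ[ℂ] ℂ)

theorem ev_restrict (F : E3 → ℂ) (hF : ContDiffOn ℝ ∞ F U) (u : U) :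
    ev u (restrict F hF) = F u := rfl

theorem ev_algebraMap (r : ℂ) (u : U) : ev u (algebraMap ℂ (smoothRing U) r) = r := rfl

theorem ext_ev {f g : smoothRing U} (h : ∀ u, ev u f = ev u g) : f = g :=
  Subtype.ext (funext h)

theorem exists_rep (f : smoothRing U) :
    ∃ F : E3 → ℂ, ContDiffOn ℝ ∞ F U ∧ ∀ u, ev u f = F u := f.2

/-- On an open set the derivative depends only on the germ, so `coordDeriv` does not depend on the
extension chosen by `rep`. -/
theorem pd_congr {F F' : E3 → ℂ} (h : ∀ u : U, F u = F' u) (a : Fin 3) (u : U) :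
    pd a F u = pd a F' u := by
  have : F =ᶠ[nhds (u : E3)] F' :=
    Filter.eventually_of_mem (U.isOpen.mem_nhds u.2) fun y hy => h ⟨y, hy⟩
  rw [pd, pd, this.fderiv_eq]

theorem contDiffOn_pd {F : E3 → ℂ} (hF : ContDiffOn ℝ ∞ F U) (a : Fin 3) :
    ContDiffOn ℝ ∞ (pd a F) U :=
  (hF.fderiv_of_isOpen U.isOpen (m := ∞) le_rfl).clm_apply contDiffOn_const

theorem differentiableAt {F : E3 → ℂ} (hF : ContDiffOn ℝ ∞ F U) (u : U) :
    DifferentiableAt ℝ F u :=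
  (hF.contDiffAt (U.isOpen.mem_nhds u.2)).differentiableAt (by simp)

/-- A function on coordinate space representing `f`. -/
noncomputable def rep (f : smoothRing U) : E3 → ℂ := (exists_rep f).choose

theorem rep_smooth (f : smoothRing U) : ContDiffOn ℝ ∞ (rep f) U := (exists_rep f).choose_spec.1

theorem ev_eq_rep (f : smoothRing U) (u : U) : ev u f = rep f u := (exists_rep f).choose_spec.2 u

/-- The coordinate derivative as a derivation of the ring of smooth functions. -/
noncomputable def coordDeriv (a : Fin 3) : Derivation ℂ (smoothRing U) (smoothRing U) :=
  Derivation.mk'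
    { toFun := fun f => restrict (pd a (rep f)) (contDiffOn_pd (rep_smooth f) a)
      map_add' := fun f g => ext_ev fun u => by
        have h : ∀ u : U, rep (f + g) u = (rep f + rep g) u := fun u => by
          simp [← ev_eq_rep]
        rw [map_add, ev_restrict, ev_restrict, ev_restrict, pd_congr h, pd,
          fderiv_add (differentiableAt (rep_smooth f) u) (differentiableAt (rep_smooth g) u)]
        rfl
      map_smul' := fun r f => ext_ev fun u => by
        have h : ∀ u : U, rep (r • f) u = (r • rep f) u := fun u => by
          simp [← ev_eq_rep]
        rw [RingHom.id_apply, map_smul, ev_restrict, ev_restrict, pd_congr h, pd,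
          fderiv_const_smul (differentiableAt (rep_smooth f) u)]
        rfl }
    fun f g => ext_ev fun u => by
      have h : ∀ u : U, rep (f * g) u = (rep f * rep g) u := fun u => by
        simp [← ev_eq_rep]
      simp only [LinearMap.coe_mk, AddHom.coe_mk, smul_eq_mul]
      rw [map_add, map_mul, map_mul, ev_restrict, ev_restrict, ev_restrict, pd_congr h, pd,
        fderiv_mul (differentiableAt (rep_smooth f) u) (differentiableAt (rep_smooth g) u),
        ev_eq_rep f, ev_eq_rep g]
      simp [pd]

theorem ev_coordDeriv {f : smoothRing U} {F : E3 → ℂ} (h : ∀ u, ev u f = F u) (a : Fin 3) (u : U) :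
    ev u (coordDeriv a f) = pd a F u :=
  pd_congr (fun u => by rw [← ev_eq_rep, h]) a u

theorem coordDeriv_comm (a b : Fin 3) (f : smoothRing U) :
    coordDeriv a (coordDeriv b f) = coordDeriv b (coordDeriv a f) := ext_ev fun u => by
  rw [ev_coordDeriv (fun u => ev_coordDeriv (ev_eq_rep f) b u),
    ev_coordDeriv (fun u => ev_coordDeriv (ev_eq_rep f) a u)]
  have hF := (rep_smooth f).contDiffAt (U.isOpen.mem_nhds u.2)
  have hs := hF.isSymmSndFDerivAt (by
    rw [minSmoothness_of_isRCLikeNormedField]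
    exact WithTop.coe_le_coe.2 (le_top (a := (2 : ℕ∞))))
  have hd : DifferentiableAt ℝ (fderiv ℝ (rep f)) u :=
    (hF.fderiv_right (m := 1) (by norm_cast)).differentiableAt (by simp)
  have key : ∀ v w : E3, fderiv ℝ (fun x => fderiv ℝ (rep f) x v) u w =
      fderiv ℝ (fderiv ℝ (rep f)) u w v := fun v w => by
    rw [fderiv_clm_apply hd (differentiableAt_const v)]
    simp
  unfold pd
  rw [key, key]
  exact hs _ _

end smoothRing

open NullGeometry.NullFrame smoothRing

/-- A null frame diagonalizes the inverse metric. -/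
theorem MetricComponents.inv_eq {G : MetricComponents} {x : E3} {k l n : Fin 3 → ℂ}
    (h : IsNull (G x) k l n) : G.inv x = coinv k l n :=
  Matrix.inv_eq_right_inv h.mul_coinv

theorem NullFrame.IsNull.isNullFrame {G : MetricComponents} {x : E3} {k l n : Fin 3 → ℂ}
    (h : IsNull (G x) k l n) : G.IsNullFrame x k l n := by
  intro a b
  have h1 : G x a b = ∑ c, G x a c * if b = c then 1 else 0 := by simp
  rw [h1]
  simp only [← h.resolution, Fin.sum_univ_three]
  ring

/-! ### Tensors in coordinates as evaluations of ring elements -/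

section Bridge

variable {U : Opens E3} {G : MetricComponents} {k l n : E3 → Fin 3 → ℂ}

/-- The components of a vector field as elements of the ring of smooth functions. -/
def vec (k : E3 → Fin 3 → ℂ) (hk : ContDiffOn ℝ ∞ k U) : Fin 3 → smoothRing U :=
  fun a => restrict (fun x => k x a) (contDiffOn_pi.1 hk a)

/-- The components of the metric as elements of the ring of smooth functions. -/
def mat (G : MetricComponents) (hG : ∀ a b, ContDiffOn ℝ ∞ (fun x => G x a b) U) :
    Matrix (Fin 3) (Fin 3) (smoothRing U) :=
  Matrix.of fun a b => restrict (fun x => G x a b) (hG a b)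

variable (hG : ∀ a b, ContDiffOn ℝ ∞ (fun x => G x a b) U)
  (hk : ContDiffOn ℝ ∞ k U) (hl : ContDiffOn ℝ ∞ l U) (hn : ContDiffOn ℝ ∞ n U)

theorem ev_ip {M : Matrix (Fin 3) (Fin 3) (smoothRing U)} {X Y : Fin 3 → smoothRing U} (u : U) :
    ev u (ip M X Y) = ∑ a, ∑ b, ev u (M a b) * ev u (X a) * ev u (Y b) := by
  simp only [ip, map_sum, map_mul]

/-- The Christoffel symbols as elements of the ring of smooth functions. -/
noncomputable def gam : Fin 3 → Fin 3 → Fin 3 → smoothRing U :=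
  levi coordDeriv (algebraMap ℂ _ (1 / 2)) (mat G hG) (coinv (vec k hk) (vec l hl) (vec n hn))

/-- The scalar `S` as an element of the ring of smooth functions. -/
noncomputable def scal : smoothRing U :=
  algebraMap ℂ _ (1 / 12) * ∑ a, ∑ b, coinv (vec k hk) (vec l hl) (vec n hn) a b *
    ric coordDeriv (gam hG hk hl hn) a b

theorem scal_eq : 4 * (3 * scal hG hk hl hn) =
      ip (ric coordDeriv (gam hG hk hl hn)) (vec k hk) (vec l hl)
      + ip (ric coordDeriv (gam hG hk hl hn)) (vec l hl) (vec k hk)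
      - 2 * ip (ric coordDeriv (gam hG hk hl hn)) (vec n hn) (vec n hn) := by
  exact sum_coinv_mul (mul_algebraMap_eq_one 12) _

variable (hF : ∀ u : U, IsNull (G u) (k u) (l u) (n u))
include hF

/-- The frame provides the inverse metric polynomially, so no determinant has to be inverted in the
ring. -/
theorem ev_coinv (a b : Fin 3) (u : U) :
    ev u (coinv (vec k hk) (vec l hl) (vec n hn) a b) = G.inv u a b := by
  rw [MetricComponents.inv_eq (hF u)]
  simp only [coinv, Matrix.of_apply, map_add, map_sub, map_mul, map_ofNat]
  rfl

theorem ev_gam (c a b : Fin 3) (u : U) :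
    ev u (gam hG hk hl hn c a b) = G.christoffel c a b u := by
  have h : ∀ a b c, ev u (coordDeriv a (mat G hG b c)) = pd a (fun y => G y b c) u :=
    fun a b c => ev_coordDeriv (fun u => rfl) a u
  simp only [gam, levi, map_sum, map_mul, map_add, map_sub, ev_algebraMap, h,
    ev_coinv hk hl hn hF, MetricComponents.christoffel]

theorem ev_conn {Y : E3 → Fin 3 → ℂ} (hY : ContDiffOn ℝ ∞ Y U)
    {X : E3 → Fin 3 → ℂ} (hX : ContDiffOn ℝ ∞ X U) (c : Fin 3) (u : U) :
    ev u (conn coordDeriv (gam hG hk hl hn) (vec X hX) (vec Y hY) c) = G.nabla X Y u c := by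
  have h : ∀ a, ev u (coordDeriv a (vec Y hY c)) = pd a (fun y => Y y c) u :=
    fun a => ev_coordDeriv (fun u => rfl) a u
  simp only [conn, map_sum, map_mul, map_add, h, ev_gam hG hk hl hn hF, MetricComponents.nabla]
  rfl

theorem ev_ric (a b : Fin 3) (u : U) :
    ev u (ric coordDeriv (gam hG hk hl hn) a b) = G.ricci a b u := by
  have h : ∀ d c a b, ev u (coordDeriv d (gam hG hk hl hn c a b)) = pd d (G.christoffel c a b) u :=
    fun d c a b => ev_coordDeriv (fun u => ev_gam hG hk hl hn hF c a b u) d u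
  simp only [ric, riem, Matrix.of_apply, map_sum, map_mul, map_add, map_sub, h,
    ev_gam hG hk hl hn hF, MetricComponents.ricci, MetricComponents.riemann]

theorem ev_scal (u : U) : ev u (scal hG hk hl hn) = G.scalarS u := by
  simp only [scal, map_sum, map_mul, ev_algebraMap, ev_coinv hk hl hn hF,
    ev_ric hG hk hl hn hF, MetricComponents.scalarS, MetricComponents.ricciScalar]

/-- Here `-Φ - (R/12)g = (R/4)g - Ric`, and `R/4 = 3S`. -/
theorem ev_schouten (a b : Fin 3) (u : U) :
    ev u (((3 * scal hG hk hl hn) • mat G hG - ric coordDeriv (gam hG hk hl hn)) a b) =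
      G.schouten a b u := by
  have h : ev u (mat G hG a b) = G u a b := rfl
  simp only [Matrix.sub_apply, Matrix.smul_apply, smul_eq_mul, map_sub, map_mul, map_ofNat,
    ev_scal hG hk hl hn hF, ev_ric hG hk hl hn hF, h, MetricComponents.schouten,
    MetricComponents.tracefreeRicci, MetricComponents.scalarS]
  ring

theorem ev_nablaForm (b c a : Fin 3) (u : U) :
    ev u (nablaForm coordDeriv (gam hG hk hl hn)
      ((3 * scal hG hk hl hn) • mat G hG - ric coordDeriv (gam hG hk hl hn)) b c a) =
      G.nablaSchouten b c a u := by
  simp only [nablaForm, map_sub, map_sum, map_mul, ev_gam hG hk hl hn hF,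
    ev_schouten hG hk hl hn hF, MetricComponents.nablaSchouten,
    ev_coordDeriv (fun u => ev_schouten hG hk hl hn hF _ _ u)]

theorem sum_cotton (c : Fin 3) (u : U) :
    ev u (∑ a, ∑ b, vec k hk a * vec k hk b * (nablaForm coordDeriv (gam hG hk hl hn)
        ((3 * scal hG hk hl hn) • mat G hG - ric coordDeriv (gam hG hk hl hn)) b c a
      - nablaForm coordDeriv (gam hG hk hl hn)
        ((3 * scal hG hk hl hn) • mat G hG - ric coordDeriv (gam hG hk hl hn)) c b a
      + mat G hG b c * coordDeriv a (3 * scal hG hk hl hn))) =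
    ∑ a, ∑ b, k u a * k u b * (G.cotton a b c u + 3 * G u b c * pd a G.scalarS u) := by
  have hS : ∀ a, ev u (coordDeriv a (3 * scal hG hk hl hn)) = 3 * pd a G.scalarS u := fun a => by
    rw [map_three_mul, map_add, map_add, ev_coordDeriv (ev_scal hG hk hl hn hF)]
    ring
  have hv : ∀ a, ev u (vec k hk a) = k u a := fun a => rfl
  have hm : ∀ a b, ev u (mat G hG a b) = G u a b := fun a b => rfl
  simp only [map_sum, map_mul, map_add, map_sub, ev_nablaForm hG hk hl hn hF, hS, hv, hm,
    MetricComponents.cotton]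
  refine Finset.sum_congr rfl fun a _ => Finset.sum_congr rfl fun b _ => ?_
  ring

theorem ev_ip_conn {X Y Z : E3 → Fin 3 → ℂ} (hX : ContDiffOn ℝ ∞ X U) (hY : ContDiffOn ℝ ∞ Y U)
    (hZ : ContDiffOn ℝ ∞ Z U) (u : U) :
    ev u (ip (mat G hG) (conn coordDeriv (gam hG hk hl hn) (vec X hX) (vec Y hY)) (vec Z hZ)) =
      G.inner u (G.nabla X Y u) (Z u) := by
  rw [ev_ip]
  simp only [ev_conn hG hk hl hn hF]
  rfl

theorem ev_ip_ric {X Y : E3 → Fin 3 → ℂ} (hX : ContDiffOn ℝ ∞ X U) (hY : ContDiffOn ℝ ∞ Y U)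
    (u : U) : ev u (ip (ric coordDeriv (gam hG hk hl hn)) (vec X hX) (vec Y hY)) =
      ∑ a, ∑ b, G.ricci a b u * X u a * Y u b := by
  rw [ev_ip]
  simp only [ev_ric hG hk hl hn hF]
  rfl

theorem isNull_vec (hs : ∀ a b, mat G hG a b = mat G hG b a) :
    IsNull (mat G hG) (vec k hk) (vec l hl) (vec n hn) := by
  have e : ∀ {X Y : E3 → Fin 3 → ℂ} (hX : ContDiffOn ℝ ∞ X U) (hY : ContDiffOn ℝ ∞ Y U) (u : U),
      ev u (ip (mat G hG) (vec X hX) (vec Y hY)) = ip (G u) (X u) (Y u) := fun hX hY u => by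
    rw [ev_ip]; rfl
  refine .of_ip (ext_ev fun u => ?_) (ext_ev fun u => ?_) (ext_ev fun u => ?_)
    (ext_ev fun u => ?_) (ext_ev fun u => ?_) (ext_ev fun u => ?_) hs
  · rw [e, (hF u).kk, map_zero]
  · rw [e, (hF u).ll, map_zero]
  · rw [e, (hF u).kl, map_one]
  · rw [e, (hF u).kn, map_zero]
  · rw [e, (hF u).ln, map_zero]
  · rw [map_mul, map_ofNat, e, (hF u).nn, map_neg, map_one]

end Bridge

/-- For a smooth null frame `k, l, n` with `k` co-geodetic and satisfying the condition on the
Cotton tensor, the components `Ric(k, k)` and `Ric(k, n)` vanish. -/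
theorem MetricComponents.ricci_eq_zero {U : Opens E3} {G : MetricComponents}
    {k l n : E3 → Fin 3 → ℂ} (hG : ∀ a b, ContDiffOn ℝ ∞ (fun x => G x a b) U)
    (hk : ContDiffOn ℝ ∞ k U) (hl : ContDiffOn ℝ ∞ l U) (hn : ContDiffOn ℝ ∞ n U)
    (hs : ∀ x ∈ U, ∀ a b, G x a b = G x b a) (hF : ∀ x ∈ U, IsNull (G x) (k x) (l x) (n x))
    (hkn : ∀ x ∈ U, G.inner x (G.nabla k n x) (k x) = 0)
    (hnn : ∀ x ∈ U, G.inner x (G.nabla n n x) (k x) = 0)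
    (hA : ∀ x ∈ U, ∀ c, ∑ a, ∑ b, k x a * k x b *
      (G.cotton a b c x + 3 * G x b c * pd a G.scalarS x) = 0) :
    ∀ x ∈ U, ∑ a, ∑ b, G.ricci a b x * k x a * k x b = 0 ∧
      ∑ a, ∑ b, G.ricci a b x * k x a * n x b = 0 ∧
      ∑ a, ∑ b, G.ricci a b x * n x a * k x b = 0 := by
  intro x hx
  replace hF : ∀ u : U, IsNull (G u) (k u) (l u) (n u) := fun u => hF u u.2
  have hs' : ∀ a b, mat G hG a b = mat G hG b a := fun a b => ext_ev fun u => hs u u.2 a b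
  have hN := isNull_vec hG hk hl hn hF hs'
  have hh : 2 * algebraMap ℂ (smoothRing U) (1 / 2) = 1 := mul_algebraMap_eq_one 2
  have hΓ : ∀ c a b, gam hG hk hl hn c a b = gam hG hk hl hn c b a := levi_symm hs'
  have hP : ∀ b c a, nablaForm coordDeriv (gam hG hk hl hn) (mat G hG) b c a = 0 :=
    nablaForm_levi hs' hN.mul_coinv hh
  have h1 : ip (mat G hG) (conn coordDeriv (gam hG hk hl hn) (vec k hk) (vec n hn))
      (vec k hk) = 0 :=
    ext_ev fun u => by rw [ev_ip_conn hG hk hl hn hF, hkn u u.2, map_zero]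
  have h2 : ip (mat G hG) (conn coordDeriv (gam hG hk hl hn) (vec n hn) (vec n hn))
      (vec k hk) = 0 :=
    ext_ev fun u => by rw [ev_ip_conn hG hk hl hn hF, hnn u u.2, map_zero]
  have main := hN.ric_eq_zero coordDeriv_comm hΓ hP hs' hh h1 h2 (scal_eq hG hk hl hn)
    (fun c => ext_ev fun u => by rw [sum_cotton hG hk hl hn hF, hA u u.2, map_zero])
  have h1 := congrArg (ev (⟨x, hx⟩ : U)) main.1
  have h2 := congrArg (ev (⟨x, hx⟩ : U)) main.2.1
  have h4 := congrArg (ev (⟨x, hx⟩ : U)) main.2.2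
  rw [map_mul, map_pow, map_zero, map_ofNat] at h2
  -- Only the values at a point lie in a field, where `5p² = 0` forces `p = 0`.
  have h3 := pow_eq_zero_iff (two_ne_zero) |>.1 ((mul_eq_zero.1 h2).resolve_left (by norm_num))
  rw [ev_ip_ric hG hk hl hn hF] at h1 h3 h4
  rw [ev_ip_ric hG hk hl hn hF, h3] at h4
  exact ⟨h1, h3, h4⟩


/-! ### Completion of a null vector field to a null frame -/

section Completion

variable {A : Type*} [CommRing A]

/-- The cross product of two vectors, with indices raised and lowered by the form `G`. -/
def NullFrame.cross (G : Matrix (Fin 3) (Fin 3) A) (k l : Fin 3 → A) : Fin 3 → A :=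
  fun a => (∑ b, G (a + 1) b * k b) * (∑ b, G (a + 2) b * l b)
    - (∑ b, G (a + 2) b * k b) * (∑ b, G (a + 1) b * l b)

variable {G : Matrix (Fin 3) (Fin 3) A} {k l : Fin 3 → A}

/-- Orthogonality is a determinant with a repeated row, and the norm is Lagrange's identity for `G`.
For null `k, l` with `g(k,l) = 1` the norm is `-det G`, so the cross product is `n` up to scale. -/
theorem NullFrame.ip_cross (hs : ∀ a b, G a b = G b a) :
    ip G k (cross G k l) = 0 ∧ ip G l (cross G k l) = 0 ∧
    ip G (cross G k l) (cross G k l) = G.det * (ip G k k * ip G l l - ip G k l ^ 2) := by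
  have e1 : (1 : Fin 3) + 1 = 2 := rfl
  have e2 : (1 : Fin 3) + 2 = 0 := rfl
  have e3 : (2 : Fin 3) + 1 = 0 := rfl
  have e4 : (2 : Fin 3) + 2 = 1 := rfl
  simp only [ip, cross, Fin.sum_univ_three, zero_add, e1, e2, e3, e4, hs 1 0, hs 2 0, hs 2 1,
    Matrix.det_fin_three]
  refine ⟨?_, ?_, ?_⟩ <;> ring

end Completion

theorem contDiffOn_ip {U : Set E3} {G : MetricComponents} {X Y : E3 → Fin 3 → ℂ}
    (hG : ∀ a b, ContDiffOn ℝ ∞ (fun x => G x a b) U) (hX : ContDiffOn ℝ ∞ X U)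
    (hY : ContDiffOn ℝ ∞ Y U) : ContDiffOn ℝ ∞ (fun x => ip (G x) (X x) (Y x)) U :=
  ContDiffOn.sum fun a _ => ContDiffOn.sum fun b _ =>
    ((hG a b).mul (contDiffOn_pi.1 hX a)).mul (contDiffOn_pi.1 hY b)

theorem contDiffOn_cross {U : Set E3} {G : MetricComponents} {X Y : E3 → Fin 3 → ℂ}
    (hG : ∀ a b, ContDiffOn ℝ ∞ (fun x => G x a b) U) (hX : ContDiffOn ℝ ∞ X U)
    (hY : ContDiffOn ℝ ∞ Y U) : ContDiffOn ℝ ∞ (fun x => cross (G x) (X x) (Y x)) U := by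
  have h : ∀ {Z : E3 → Fin 3 → ℂ}, ContDiffOn ℝ ∞ Z U → ∀ a,
      ContDiffOn ℝ ∞ (fun x => ∑ b, G x a b * Z x b) U := fun hZ a =>
    ContDiffOn.sum fun b _ => (hG a b).mul (contDiffOn_pi.1 hZ b)
  exact contDiffOn_pi.2 fun a => ((h hX _).mul (h hY _)).sub ((h hX _).mul (h hY _))

theorem contDiffOn_det {U : Set E3} {G : MetricComponents}
    (hG : ∀ a b, ContDiffOn ℝ ∞ (fun x => G x a b) U) :
    ContDiffOn ℝ ∞ (fun x => (G x).det) U := by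
  simp only [Matrix.det_fin_three]
  exact ((((((hG 0 0).mul (hG 1 1)).mul (hG 2 2)).sub (((hG 0 0).mul (hG 1 2)).mul (hG 2 1))).sub
    (((hG 0 1).mul (hG 1 0)).mul (hG 2 2))).add (((hG 0 1).mul (hG 1 2)).mul (hG 2 0))).add
    (((hG 0 2).mul (hG 1 0)).mul (hG 2 1)) |>.sub (((hG 0 2).mul (hG 1 1)).mul (hG 2 0))

/-- A smooth complex function has a smooth square root near a point where it does not vanish. -/
theorem exists_smooth_sqrt {U : Set E3} (hU : IsOpen U) {f : E3 → ℂ} (hf : ContDiffOn ℝ ∞ f U)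
    {x : E3} (hx : x ∈ U) (h0 : f x ≠ 0) :
    ∃ V : Set E3, IsOpen V ∧ x ∈ V ∧ V ⊆ U ∧ ∃ s : E3 → ℂ, ContDiffOn ℝ ∞ s V ∧
      ∀ y ∈ V, s y ^ 2 = f y ∧ s y ≠ 0 := by
  obtain ⟨r, hr⟩ := IsAlgClosed.exists_pow_nat_eq (f x) (n := 2) two_pos
  have hr0 : r ≠ 0 := by rintro rfl; exact h0 (by rw [← hr]; simp)
  have hq : ContDiffOn ℝ ∞ (fun y => f y / f x) U := hf.div_const _
  -- The quotient `f y / f x` is `1` at `x`, so near `x` it stays in the domain where the principal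
  -- logarithm is smooth.
  refine ⟨U ∩ (fun y => f y / f x) ⁻¹' Complex.slitPlane,
    hq.continuousOn.isOpen_inter_preimage hU Complex.isOpen_slitPlane, ⟨hx, ?_⟩,
    Set.inter_subset_left, fun y => r * Complex.exp (Complex.log (f y / f x) / 2), ?_, ?_⟩
  · simp [div_self h0]
  · have hl : ContDiffOn ℝ ∞ (fun y => Complex.log (f y / f x))
        (U ∩ (fun y => f y / f x) ⁻¹' Complex.slitPlane) := fun y hy =>
      ContDiffAt.comp_contDiffWithinAt (g := Complex.log) y
        ((Complex.contDiffAt_log hy.2).restrict_scalars ℝ) ((hq y hy.1).mono Set.inter_subset_left)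
    exact contDiffOn_const.mul (hl.div_const 2).cexp
  · rintro y ⟨-, hy⟩
    refine ⟨?_, mul_ne_zero hr0 (Complex.exp_ne_zero _)⟩
    rw [mul_pow, hr, ← Complex.exp_nat_mul]
    rw [show ((2 : ℕ) : ℂ) * (Complex.log (f y / f x) / 2) = Complex.log (f y / f x) by
      push_cast; ring, Complex.exp_log (Complex.slitPlane_ne_zero hy)]
    field_simp

/-- A smooth null vector field can be completed to a smooth null frame near a point where it does
not vanish. -/
theorem exists_nullFrame {U : Set E3} (hU : IsOpen U) {G : MetricComponents}
    (hG : ∀ a b, ContDiffOn ℝ ∞ (fun x => G x a b) U) (hs : ∀ x ∈ U, ∀ a b, G x a b = G x b a)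
    {k : E3 → Fin 3 → ℂ} (hk : ContDiffOn ℝ ∞ k U) (hkk : ∀ x ∈ U, ip (G x) (k x) (k x) = 0)
    {x : E3} (hx : x ∈ U) (hdet : (G x).det ≠ 0) (hk0 : k x ≠ 0) :
    ∃ V : Set E3, IsOpen V ∧ x ∈ V ∧ V ⊆ U ∧ ∃ l n : E3 → Fin 3 → ℂ,
      ContDiffOn ℝ ∞ l V ∧ ContDiffOn ℝ ∞ n V ∧
      ∀ y ∈ V, IsNull (G y) (k y) (l y) (n y) := by
  obtain ⟨w, hw⟩ : ∃ w : Fin 3 → ℂ, ip (G x) (k x) w ≠ 0 := by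
    by_contra! h
    refine hk0 (Matrix.eq_zero_of_vecMul_eq_zero hdet (funext fun b => ?_))
    have := h (Pi.single b 1)
    simpa [ip, Matrix.vecMul, dotProduct, Pi.single_apply, mul_comm] using this
  -- Dividing the cross product by a root of `2 det G` turns its norm `-det G` into `-1/2`.
  obtain ⟨V, hV, hxV, hVU, s, hsm, hs2⟩ := exists_smooth_sqrt hU
    (contDiffOn_const.mul (contDiffOn_det hG) : ContDiffOn ℝ ∞ (fun y => 2 * (G y).det) U) hx
    (mul_ne_zero two_ne_zero hdet)
  have hG' : ∀ a b, ContDiffOn ℝ ∞ (fun x => G x a b) V := fun a b => (hG a b).mono hVU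
  have hq : ContDiffOn ℝ ∞ (fun y => ip (G y) (k y) w) V :=
    contDiffOn_ip hG' (hk.mono hVU) contDiffOn_const
  have hqw : ContDiffOn ℝ ∞ (fun y => ip (G y) w w) V :=
    contDiffOn_ip hG' contDiffOn_const contDiffOn_const
  set W := V ∩ (fun y => ip (G y) (k y) w) ⁻¹' {0}ᶜ with hW
  have hWV : W ⊆ V := Set.inter_subset_left
  -- The first term normalizes `g(k,l) = 1`; the multiple of `k` makes `l` null without changing
  -- that.
  let l : E3 → Fin 3 → ℂ := fun y => (ip (G y) (k y) w)⁻¹ • w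
    + (-(1 / 2) * (ip (G y) (k y) w)⁻¹ ^ 2 * ip (G y) w w) • k y
  have hq' : ContDiffOn ℝ ∞ (fun y => (ip (G y) (k y) w)⁻¹) W :=
    (hq.mono hWV).inv fun y hy => hy.2
  have hl : ContDiffOn ℝ ∞ l W :=
    (hq'.smul contDiffOn_const).add
      (((contDiffOn_const.mul (hq'.pow 2)).mul (hqw.mono hWV)).smul (hk.mono (hWV.trans hVU)))
  refine ⟨W, hq.continuousOn.isOpen_inter_preimage hV isOpen_compl_singleton, ⟨hxV, hw⟩,
    hWV.trans hVU, l, fun y => (s y)⁻¹ • cross (G y) (k y) (l y), hl, ?_, fun y hy => ?_⟩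
  · exact ((hsm.mono hWV).inv fun y hy => (hs2 y (hWV hy)).2).smul
      (contDiffOn_cross (fun a b => (hG' a b).mono hWV) (hk.mono (hWV.trans hVU)) hl)
  · have hsy := hs y (hVU (hWV hy))
    have h0 : ip (G y) (k y) w ≠ 0 := hy.2
    have kk := hkk y (hVU (hWV hy))
    obtain ⟨h2, hs0⟩ := hs2 y (hWV hy)
    obtain ⟨c1, c2, c3⟩ := ip_cross (k := k y) (l := l y) hsy
    have kl : ip (G y) (k y) (l y) = 1 := by
      simp only [l, ip_add_right, ip_smul_right, kk]
      field_simp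
      simp
    have ll : ip (G y) (l y) (l y) = 0 := by
      simp only [l, ip_add_right, ip_smul_right, ip_add_left, ip_smul_left, kk,
        ip_comm hsy (X := w) (Y := k y)]
      field_simp
      ring
    refine .of_ip kk ll kl ?_ ?_ ?_ hsy
    · rw [ip_smul_right, c1, mul_zero]
    · rw [ip_smul_right, c2, mul_zero]
    · rw [ip_smul_right, ip_smul_left, c3, kk, kl]
      field_simp
      linear_combination h2

/-! ### Components in a chart -/

section Charts

variable {M : Type*} [TopologicalSpace M] [ChartedSpace E3 M]

/-- The derivative of the inverse chart is a linear isomorphism, and extending scalars to `ℂ` keeps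
a basis. -/
theorem exists_basis_coordVec [IsManifold (𝓡 3) ∞ M] {e : OpenPartialHomeomorph M E3}
    (he : e ∈ charts M) {x : E3} (hx : x ∈ e.target) :
    ∃ b : Module.Basis (Fin 3) ℂ (CTangent (e.symm x)),
      ∀ a, b a = (1 : ℂ) ⊗ₜ[ℝ] coordVec e x a := by
  have hd : e.MDifferentiable (𝓡 3) (𝓡 3) :=
    ⟨(contMDiffOn_of_mem_maximalAtlas he).mdifferentiableOn (by simp),
      (contMDiffOn_symm_of_mem_maximalAtlas he).mdifferentiableOn (by simp)⟩
  let φ := hd.symm.mfderiv (x := x) hx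
  let b : Module.Basis (Fin 3) ℝ (TangentSpace (𝓡 3) x) :=
    (EuclideanSpace.basisFun (Fin 3) ℝ).toBasis
  have hb : ∀ a, b a = (EuclideanSpace.single a (1 : ℝ) : E3) := fun a => by
    change (EuclideanSpace.basisFun (Fin 3) ℝ).toBasis a = _
    rw [OrthonormalBasis.coe_toBasis, EuclideanSpace.basisFun_apply]
  refine ⟨(b.map φ.toLinearEquiv).baseChange ℂ, fun a => ?_⟩
  rw [Module.Basis.baseChange_apply, Module.Basis.map_apply, hb]
  rfl

theorem ofComponents_eq (e : OpenPartialHomeomorph M E3) (x : E3) (v : Fin 3 → ℂ) :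
    ofComponents e x v = ∑ a, v a • ((1 : ℂ) ⊗ₜ[ℝ] coordVec e x a) := by
  simp [ofComponents, TensorProduct.smul_tmul']

theorem ofComponents_zero (e : OpenPartialHomeomorph M E3) (x : E3) :
    ofComponents e x 0 = 0 :=
  Finset.sum_eq_zero fun _ _ => TensorProduct.zero_tmul _ _

theorem ComplexMetric.form_ofComponents (g : ComplexMetric M) (e : OpenPartialHomeomorph M E3)
    (x : E3) (v w : Fin 3 → ℂ) :
    g.form (e.symm x) (ofComponents e x v) (ofComponents e x w) =
      ip (g.components e x) v w := by
  simp only [ofComponents_eq, map_sum, LinearMap.sum_apply, map_smul, LinearMap.smul_apply,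
    smul_eq_mul, ip, ComplexMetric.components, formComponents, Matrix.of_apply]
  simp only [Fin.sum_univ_three]
  ring

theorem ComplexMetric.det_components_ne_zero [IsManifold (𝓡 3) ∞ M] (g : ComplexMetric M)
    {e : OpenPartialHomeomorph M E3} (he : e ∈ charts M) {x : E3} (hx : x ∈ e.target) :
    (g.components e x).det ≠ 0 := by
  obtain ⟨b, hb⟩ := exists_basis_coordVec he hx
  intro h
  obtain ⟨v, hv, hv0⟩ := Matrix.exists_vecMul_eq_zero_iff.2 h
  have hb' : ∀ w, ofComponents e x w = ∑ a, w a • b a := fun w => by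
    simp only [ofComponents_eq, hb]
  have h1 : ofComponents e x v = 0 := g.nondegenerate _ _ fun w => by
    rw [← b.sum_repr w, ← hb', g.form_ofComponents]
    have h2 : ip (g.components e x) v (b.repr w) =
        ∑ c, Matrix.vecMul v (g.components e x) c * b.repr w c := by
      simp only [ip, Matrix.vecMul, dotProduct, Fin.sum_univ_three]
      ring
    rw [h2, hv0]
    simp
  rw [hb'] at h1
  exact hv (funext (Fintype.linearIndependent_iff.1 b.linearIndependent v h1))

end Charts

/-- A double root at zero of the polynomial of the tracefree Ricci tensor. -/
theorem MetricComponents.sq_dvd_ricciPoly {G : MetricComponents} {x : E3} {k l n : Fin 3 → ℂ}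
    (h1 : ∑ a, ∑ b, G.tracefreeRicci a b x * k a * k b = 0)
    (h2 : ∑ a, ∑ b, G.tracefreeRicci a b x * k a * n b = 0)
    (h3 : ∑ a, ∑ b, G.tracefreeRicci a b x * n a * k b = 0) :
    (Polynomial.X - Polynomial.C 0) ^ 2 ∣ G.ricciPoly x k l n := by
  rw [Polynomial.C_0, sub_zero]
  -- The witness collects the coefficients of `Φ(z)` from degree two on; the hypotheses kill degrees
  -- zero and one.
  refine ⟨Polynomial.C (1 / 2) * ∑ a, ∑ b, Polynomial.C (G.tracefreeRicci a b x) *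
    (Polynomial.C (4 * n a * n b + k a * l b + l a * k b)
      + Polynomial.C (2 * n a * l b + 2 * l a * n b) * Polynomial.X
      + Polynomial.C (l a * l b) * Polynomial.X ^ 2), ?_⟩
  have e1 := congrArg (Polynomial.C (R := ℂ)) h1
  have e2 := congrArg (Polynomial.C (R := ℂ)) h2
  have e3 := congrArg (Polynomial.C (R := ℂ)) h3
  simp only [ricciPoly, xiPoly, Fin.sum_univ_three, map_add, map_mul, map_zero, map_ofNat]
    at e1 e2 e3 ⊢
  linear_combination Polynomial.C (1 / 2) * e1
    + 2 * Polynomial.C (1 / 2) * Polynomial.X * (e2 + e3)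

end NullGeometry

/-! ### Assembly of the theorem -/

open NullGeometry NullGeometry.NullFrame in
theorem mainTheorem4 {M : Type*} [TopologicalSpace M]
    [ChartedSpace (EuclideanSpace ℝ (Fin 3)) M] [IsManifold (𝓡 3) ∞ M]
    (g : NullGeometry.ComplexMetric M) (N : NullGeometry.NullStructure g)
    (hN : N.IsCoGeodetic) (hA : N.CottonCondition) :
    ∀ e ∈ NullGeometry.charts M, ∀ x ∈ e.target,
      g.IsAlgebraicallySpecialAt e x ∧ g.IsMultiplePrincipalAt e x (N.line (e.symm x)) := by
  suffices h : ∀ e ∈ NullGeometry.charts M, ∀ x ∈ e.target,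
      g.IsMultiplePrincipalAt e x (N.line (e.symm x)) from
    fun e he x hx => ⟨⟨_, h e he x hx⟩, h e he x hx⟩
  intro e he x hx
  obtain ⟨U, hU, hxU, hUe, k, hk, hspan⟩ := N.smooth e he x hx
  have hG : ∀ a b, ContDiffOn ℝ ∞ (fun y => g.components e y a b) U :=
    fun a b => (g.smooth e he a b).mono hUe
  have hs : ∀ y, ∀ a b, g.components e y a b = g.components e y b a :=
    fun y a b => g.symm _ _ _
  have hmem : ∀ y ∈ U, ofComponents e y (k y) ∈ N.line (e.symm y) := fun y hy => by
    rw [hspan y hy]; exact Submodule.mem_span_singleton_self _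
  have hkk : ∀ y ∈ U, ip (g.components e y) (k y) (k y) = 0 := fun y hy => by
    rw [← g.form_ofComponents]; exact N.null _ _ (hmem y hy)
  have hk0 : k x ≠ 0 := fun h0 => by
    have h1 := N.finrank_line (e.symm x)
    rw [hspan x hxU, h0, ofComponents_zero, Submodule.span_zero_singleton, finrank_bot] at h1
    exact zero_ne_one h1
  obtain ⟨V, hV, hxV, hVU, l, n, hl, hn, hF⟩ := exists_nullFrame hU hG (fun y _ => hs y) hk hkk hxU
    (g.det_components_ne_zero he hx) hk0
  have perp : ∀ y ∈ V, ∀ v, ip (g.components e y) v (k y) = 0 →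
      ofComponents e y v ∈ N.perp (e.symm y) := fun y hy v hv w hw => by
    rw [hspan y (hVU hy), Submodule.mem_span_singleton] at hw
    obtain ⟨c, rfl⟩ := hw
    rw [map_smul, g.form_ofComponents, hv, smul_zero]
  have pk : ∀ y ∈ V, ofComponents e y (k y) ∈ N.perp (e.symm y) :=
    fun y hy => perp y hy _ (hF y hy).kk
  have pn : ∀ y ∈ V, ofComponents e y (n y) ∈ N.perp (e.symm y) :=
    fun y hy => perp y hy _ (by rw [ip_comm (hs y)]; exact (hF y hy).kn)
  have hkV := hk.mono hVU
  have mk : ∀ y ∈ V, ofComponents e y (k y) ∈ N.line (e.symm y) := fun y hy => hmem y (hVU hy)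
  obtain ⟨r1, r2, r3⟩ := MetricComponents.ricci_eq_zero (U := ⟨V, hV⟩)
    (fun a b => (hG a b).mono hVU) hkV hl hn (fun y _ => hs y) hF
    (hN e he V hV (hVU.trans hUe) k n k hkV hn hkV pk pn mk)
    (hN e he V hV (hVU.trans hUe) n n k hn hn hkV pn pn mk)
    (hA e he V hV (hVU.trans hUe) k ⟨hkV, fun y hy => hspan y (hVU hy)⟩) x hxV
  -- On orthogonal pairs the trace term drops out, so Ricci and its tracefree part agree.
  have tf : ∀ v w : Fin 3 → ℂ, ip (g.components e x) v w = 0 →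
      ∑ a, ∑ b, (g.components e).ricci a b x * v a * w b = 0 →
      ∑ a, ∑ b, (g.components e).tracefreeRicci a b x * v a * w b = 0 := fun v w h1 h2 => by
    simp only [ip, MetricComponents.tracefreeRicci, Fin.sum_univ_three] at h1 h2 ⊢
    linear_combination h2 - 1 / 3 * (g.components e).ricciScalar x * h1
  have hx' := hF x hxV
  -- The root is `z = 0` because `ξ(0) = k`.
  refine ⟨k x, l x, n x, hx'.isNullFrame, 0, ?_, MetricComponents.sq_dvd_ricciPoly
    (tf _ _ hx'.kk r1) (tf _ _ hx'.kn r2) (tf _ _ (by rw [ip_comm (hs x)]; exact hx'.kn) r3)⟩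
  rw [hspan x hxU]
  congr
  funext a
  simp [xiVec]
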